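/- For real $1\le p<\infty$ and real $\alpha,m>0$, let $\mathcal F^p_{(\alpha,m)}$ be the space of entire functions $f$ with $$\|f\|^p=\int_{\mathbb C}|f(z)|^p e^{-p\alpha|z|^m}\,dA(z)<\infty,$$ where $dA$ is Lebesgue area measure. Let $Hf(z)=\frac1z\int_0^z f(w)\,dw$ (with $Hf(0)=f(0)$) be the Hardy operator and $Df=f'$ the differentiation operator. A bounded linear operator $T$ on a complex normed space $X$ satisfies Ritt's resolvent condition if there is a constant $C>0$ such that for every $\lambda\in\mathbb C$ with $|\lambda|>1$ the operator $T-\lambda I$ is invertible in $\mathcal L(X)$ and $\|(T-\lambda I)^{-1}\|\le \frac{C}{|\lambda-1|}$; it is power bounded if $\sup_{n\ge0}\|T^n\|<\infty$; it is uniformly mean ergodic if the means $\frac1n\sum_{k=1}^nT^k$ converge in operator norm to an element of $\mathcal L(X)$. To say that $H$ or $D$ has one of these properties on $\mathcal F^p_{(\alpha,m)}$ includes that it is a bounded operator from $\mathcal F^p_{(\alpha,m)}$ into itself. **Proposition 5.1.** Let $1\le p<\infty$ and $\alpha,m>0$. Then (i) the Hardy operator $H$ is bounded on $\mathcal F^p_{(\alpha,m)}$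 and satisfies Ritt's resolvent condition there; (ii) the following are equivalent: (a) the differentiation operator $D$ is bounded on $\mathcal F^p_{(\alpha,m)}$ and satisfies Ritt's resolvent condition there; (b) $D$ is bounded on $\mathcal F^p_{(\alpha,m)}$, power bounded and uniformly mean ergodic there; (c) $m<1$, or $m=1$ and $\alpha<1$. -/

import Mathlib

open MeasureTheory Filter Topology

noncomputable section

namespace Fock

/-- The weight `e^{-α |z|^m}` on the complex plane. -/
def weight (α m : ℝ) (z : ℂ) : ℝ := Real.exp (-(α * ‖z‖ ^ m))

/-- The integrand `|f(z)|^p e^{-p α |z|^m}` of the generalized Fock norm. -/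
def density (p α m : ℝ) (f : ℂ → ℂ) (z : ℂ) : ℝ :=
  ‖f z‖ ^ p * Real.exp (-(p * α * ‖z‖ ^ m))

lemma measurable_weight (α m : ℝ) : Measurable (weight α m) := by
  unfold weight; fun_prop

lemma density_eq (p α m : ℝ) (f : ℂ → ℂ) (z : ℂ) :
    density p α m f z = ‖(weight α m z : ℂ) * f z‖ ^ p := by
  have hw : 0 ≤ weight α m z := (Real.exp_pos _).le
  rw [norm_mul, Complex.norm_real, Real.norm_of_nonneg hw,
    Real.mul_rpow hw (norm_nonneg _), mul_comm, density, weight, ← Real.exp_mul]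
  ring_nf

lemma toReal_exponent (p : ℝ) [hp : Fact (1 ≤ p)] : (ENNReal.ofReal p).toReal = p :=
  ENNReal.toReal_ofReal (zero_le_one.trans hp.out)

lemma exponent_ne_zero (p : ℝ) [hp : Fact (1 ≤ p)] : ENNReal.ofReal p ≠ 0 := by
  have := hp.out
  simp only [ne_eq, ENNReal.ofReal_eq_zero, not_le]
  linarith

lemma aestronglyMeasurable_weighted (α m : ℝ) {f : ℂ → ℂ} (hf : Differentiable ℂ f) :
    AEStronglyMeasurable (fun z => (weight α m z : ℂ) * f z) volume :=
  ((Complex.measurable_ofReal.comp (measurable_weight α m)).mul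
    hf.continuous.measurable).aestronglyMeasurable

lemma integrable_density_iff (p α m : ℝ) [hp : Fact (1 ≤ p)] {f : ℂ → ℂ}
    (hf : Differentiable ℂ f) :
    Integrable (density p α m f) ↔
      MemLp (fun z => (weight α m z : ℂ) * f z) (ENNReal.ofReal p) := by
  rw [← integrable_norm_rpow_iff (aestronglyMeasurable_weighted α m hf) (exponent_ne_zero p)
    ENNReal.ofReal_ne_top, toReal_exponent]
  exact iff_of_eq (congrArg (fun g => Integrable g) (funext (density_eq p α m f)))

/-- The set of entire functions `f` with `∫ |f(z)|^p e^{-p α |z|^m} dA(z) < ∞`, as a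
complex vector space. -/
def fockSubmodule (p α m : ℝ) [hp : Fact (1 ≤ p)] : Submodule ℂ (ℂ → ℂ) where
  carrier := {f | Differentiable ℂ f ∧ Integrable (density p α m f)}
  zero_mem' := by
    refine ⟨differentiable_const _, ?_⟩
    rw [integrable_density_iff p α m (f := 0) (differentiable_const _)]
    simp
  add_mem' := by
    rintro f g ⟨hf, hf'⟩ ⟨hg, hg'⟩
    refine ⟨hf.add hg, ?_⟩
    rw [integrable_density_iff p α m (hf.add hg)]
    rw [integrable_density_iff p α m hf] at hf'
    rw [integrable_density_iff p α m hg] at hg'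
    simpa [mul_add, Pi.add_def] using hf'.add hg'
  smul_mem' := by
    rintro c f ⟨hf, hf'⟩
    refine ⟨hf.const_smul c, ?_⟩
    rw [integrable_density_iff p α m (hf.const_smul c)]
    rw [integrable_density_iff p α m hf] at hf'
    simpa [Pi.smul_def, mul_left_comm] using hf'.const_smul c

end Fock

/-- The generalized Fock space `F^p_{(α,m)}`. It is a separate type, so that its topology is the
one of its norm and not the topology of pointwise convergence. -/
def FockSpace (p α m : ℝ) [Fact (1 ≤ p)] : Type := ↥(Fock.fockSubmodule p α m)

namespace FockSpace

variable {p α m : ℝ} [hp : Fact (1 ≤ p)]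

instance : AddCommGroup (FockSpace p α m) :=
  inferInstanceAs (AddCommGroup ↥(Fock.fockSubmodule p α m))

instance : Module ℂ (FockSpace p α m) :=
  inferInstanceAs (Module ℂ ↥(Fock.fockSubmodule p α m))

/-- The entire function underlying an element of the Fock space. -/
def toFun (f : FockSpace p α m) : ℂ → ℂ := Submodule.subtype (Fock.fockSubmodule p α m) f

instance : CoeFun (FockSpace p α m) (fun _ => ℂ → ℂ) := ⟨toFun⟩

/-- The element of the Fock space given by an entire function of finite norm. -/
def mk (f : ℂ → ℂ) (hf : Differentiable ℂ f) (hf' : Integrable (Fock.density p α m f)) :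
    FockSpace p α m := (⟨f, hf, hf'⟩ : ↥(Fock.fockSubmodule p α m))

lemma mk_apply (f : ℂ → ℂ) (hf : Differentiable ℂ f) (hf' : Integrable (Fock.density p α m f))
    (z : ℂ) : (mk f hf hf' : FockSpace p α m) z = f z := rfl

lemma ext_apply {f g : FockSpace p α m} (h : ∀ z, f z = g z) : f = g :=
  Subtype.ext (funext h)

lemma zero_apply (z : ℂ) : (0 : FockSpace p α m) z = 0 := rfl

lemma add_apply (f g : FockSpace p α m) (z : ℂ) : (f + g) z = f z + g z := rfl

lemma smul_apply (c : ℂ) (f : FockSpace p α m) (z : ℂ) : (c • f) z = c * f z := rfl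

/-- `‖f‖ = (∫ |f(z)|^p e^{-p α |z|^m} dA(z))^{1/p}`. -/
instance : Norm (FockSpace p α m) :=
  ⟨fun f => (∫ z : ℂ, Fock.density p α m f z) ^ (1 / p)⟩

lemma norm_eq (f : FockSpace p α m) :
    ‖f‖ = (∫ z : ℂ, Fock.density p α m f z) ^ (1 / p) := rfl

lemma differentiable (f : FockSpace p α m) : Differentiable ℂ f.toFun :=
  (show ↥(Fock.fockSubmodule p α m) from f).2.1

lemma integrable_density (f : FockSpace p α m) : Integrable (Fock.density p α m f) :=
  (show ↥(Fock.fockSubmodule p α m) from f).2.2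

lemma memLp (f : FockSpace p α m) :
    MemLp (fun z => (Fock.weight α m z : ℂ) * f z) (ENNReal.ofReal p) :=
  (Fock.integrable_density_iff p α m f.differentiable).1 f.integrable_density

lemma norm_eq_toReal_eLpNorm (f : FockSpace p α m) :
    ‖f‖ = (eLpNorm (fun z => (Fock.weight α m z : ℂ) * f z) (ENNReal.ofReal p) volume).toReal := by
  rw [f.memLp.eLpNorm_eq_integral_rpow_norm (Fock.exponent_ne_zero p) ENNReal.ofReal_ne_top,
    ENNReal.toReal_ofReal (by positivity), Fock.toReal_exponent, norm_eq, one_div]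
  simp_rw [Fock.density_eq]

lemma normCore : NormedSpace.Core ℂ (FockSpace p α m) where
  norm_nonneg f := by rw [norm_eq_toReal_eLpNorm]; exact ENNReal.toReal_nonneg
  norm_smul c f := by
    have h : (fun z => (Fock.weight α m z : ℂ) * (c • f : FockSpace p α m) z) =
        c • fun z => (Fock.weight α m z : ℂ) * f z := by
      funext z
      simp only [smul_apply, Pi.smul_apply, smul_eq_mul]
      ring
    rw [norm_eq_toReal_eLpNorm, norm_eq_toReal_eLpNorm, h, eLpNorm_const_smul, ENNReal.toReal_mul]
    simp
  norm_triangle f g := by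
    have h : (fun z => (Fock.weight α m z : ℂ) * (f + g : FockSpace p α m) z) =
        (fun z => (Fock.weight α m z : ℂ) * f z) + fun z => (Fock.weight α m z : ℂ) * g z := by
      funext z
      simp [add_apply, mul_add]
    rw [norm_eq_toReal_eLpNorm, norm_eq_toReal_eLpNorm, norm_eq_toReal_eLpNorm, h,
      ← ENNReal.toReal_add f.memLp.eLpNorm_ne_top g.memLp.eLpNorm_ne_top]
    refine ENNReal.toReal_mono
      (ENNReal.add_ne_top.2 ⟨f.memLp.eLpNorm_ne_top, g.memLp.eLpNorm_ne_top⟩) ?_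
    exact eLpNorm_add_le f.memLp.aestronglyMeasurable g.memLp.aestronglyMeasurable
      (by simpa using ENNReal.ofReal_le_ofReal hp.out)
  norm_eq_zero_iff f := by
    constructor
    · intro h
      rw [norm_eq_toReal_eLpNorm, ENNReal.toReal_eq_zero_iff,
        or_iff_left f.memLp.eLpNorm_ne_top, eLpNorm_eq_zero_iff f.memLp.aestronglyMeasurable
          (Fock.exponent_ne_zero p)] at h
      have h' : f.toFun =ᵐ[volume] fun _ => (0 : ℂ) := by
        filter_upwards [h] with z hz
        have hw : (Fock.weight α m z : ℂ) ≠ 0 := by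
          simp [Fock.weight]
        exact (mul_eq_zero.1 hz).resolve_left hw
      exact ext_apply (congrFun ((Continuous.ae_eq_iff_eq volume f.differentiable.continuous
        continuous_const).1 h'))
    · rintro rfl
      rw [norm_eq_toReal_eLpNorm]
      have h : (fun z => (Fock.weight α m z : ℂ) * (0 : FockSpace p α m) z) = 0 := by
        funext z
        change (Fock.weight α m z : ℂ) * 0 = 0
        simp
      rw [h]; simp

instance : NormedAddCommGroup (FockSpace p α m) := NormedAddCommGroup.ofCore normCore

instance : NormedSpace ℂ (FockSpace p α m) := NormedSpace.ofCore normCore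

end FockSpace

namespace Fock

/-- The integration operator `J f(z) = ∫_0^z f(w) dw`, the path integral along the segment
from `0` to `z`, parametrized by `w = t z`, `0 ≤ t ≤ 1`. -/
def integration (f : ℂ → ℂ) (z : ℂ) : ℂ := ∫ t in (0 : ℝ)..1, f (t * z) * z

/-- The Hardy operator `H f(z) = (1/z) ∫_0^z f(w) dw`, with its limit `f(0)` as the value at the
removable singularity `z = 0`. -/
def hardy (f : ℂ → ℂ) (z : ℂ) : ℂ := if z = 0 then f 0 else 1 / z * integration f z

/-- The continuous linear operator `T` on `F^p_{(α,m)}` is the operator `A`, i.e.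
`A` maps `F^p_{(α,m)}` into itself, is bounded there, and `T` is its restriction. -/
def IsRealizedBy {p α m : ℝ} [Fact (1 ≤ p)] (A : (ℂ → ℂ) → ℂ → ℂ)
    (T : FockSpace p α m →L[ℂ] FockSpace p α m) : Prop :=
  ∀ f : FockSpace p α m, ∀ z : ℂ, (T f) z = A f z

section

variable {X : Type*} [NormedAddCommGroup X] [NormedSpace ℂ X]

/-- Ritt's resolvent condition: there is `C > 0` such that for every `|μ| > 1` the operator
`T - μ I` has a bounded inverse `R`, of norm at most `C / |μ - 1|`. -/
def RittCondition (T : X →L[ℂ] X) : Prop :=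
  ∃ C : ℝ, 0 < C ∧ ∀ μ : ℂ, 1 < ‖μ‖ →
    ∃ R : X →L[ℂ] X,
      (T - μ • ContinuousLinearMap.id ℂ X) ∘L R = ContinuousLinearMap.id ℂ X ∧
      R ∘L (T - μ • ContinuousLinearMap.id ℂ X) = ContinuousLinearMap.id ℂ X ∧
      ‖R‖ ≤ C / ‖μ - 1‖

/-- `T` is power bounded: `‖T^n‖ ≤ M` for all `n ≥ 0`. -/
def PowerBounded (T : X →L[ℂ] X) : Prop :=
  ∃ M : ℝ, 0 < M ∧ ∀ n : ℕ, ‖T ^ n‖ ≤ M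

/-- `T` is uniformly mean ergodic: the means `(1/n) ∑_{k=1}^n T^k` converge in operator norm. -/
def UniformlyMeanErgodic (T : X →L[ℂ] X) : Prop :=
  ∃ P : X →L[ℂ] X,
    Tendsto (fun n : ℕ => (1 / (n : ℂ)) • ∑ k ∈ Finset.Icc 1 n, T ^ k) atTop (𝓝 P)

end

end Fock

end

/-!
The weight is radial, so rotations are isometries of the Fock space. Poisson's formula writes the
dilate `f (ζ z)`, `|ζ| < 1`, as an average of the rotations `f (e^{iθ} z)`, and Minkowski's integral
inequality (`Fock.eLpNorm_integral_mul_le`) makes every dilation by `|ζ| ≤ 1` a contraction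
(`Fock.weightedENorm_dilation_le`). Averages of dilations are therefore bounded, and they act on
Taylor coefficients as multipliers.

The Hardy operator is `H f (z) = ∫₀¹ f (t z) dt`, the multiplier `1 / (n + 1)`. With `w = 1 - 1/μ`,
the resolvent `(H - μ)⁻¹` is `-μ⁻¹ (1 + μ⁻¹ R_w)`, where `R_w` is the multiplier `1 / (w + n)`. Since
dilations by complex factors are contractions as well, the Laplace integral for `R_w` may be taken
along the ray on which `w s` is positive, which gives `‖R_w‖ ≤ 1 / |w|`
(`FockSpace.exists_dilation_resolvent`) and hence Ritt's condition.

If `m ≤ 1`, then `|z|^m` is subadditive, translation by `v` has norm at most `e^{α |v|^m}`, and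
Cauchy's formula yields `‖D^n‖ ≤ n! R^{-n} e^{α R^m}` for every `R > 0`. If moreover
`α R^m ≤ β R + C` with `β < 1`, the choice `R = n / β` and Stirling's formula make `∑ ‖D^n‖`
converge. This gives power boundedness, means tending to `0`, and, the space being complete, Ritt's
condition through the Neumann series. In the remaining cases `e^{l z}` belongs to the space for all
`|l| < 1`, so the open unit disc consists of eigenvalues of `D`: eigenvalues near `-1` contradict
Ritt's condition, and eigenvalues near `1` contradict convergence of the means in norm.
-/

open scoped ENNReal

namespace Fock

/-! ### Minkowski's integral inequality -/

/-- Minkowski's integral inequality, for a family `h` that is uniformly bounded in `L^p`. -/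
theorem eLpNorm_integral_mul_le {Ω E : Type*} [MeasurableSpace Ω] [MeasurableSpace E]
    {ν : Measure Ω} [SFinite ν] {μ : Measure E} [SFinite μ] {p : ℝ} (hp : 1 ≤ p)
    {g : Ω → ℂ} {h : Ω → E → ℂ} (hg : Measurable g)
    (hh : Measurable (Function.uncurry h)) {B : ℝ≥0∞}
    (hB : ∀ᵐ t ∂ν, eLpNorm (h t) (ENNReal.ofReal p) μ ≤ B) :
    eLpNorm (fun z => ∫ t, g t * h t z ∂ν) (ENNReal.ofReal p) μ ≤ (∫⁻ t, ‖g t‖ₑ ∂ν) * B := by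
  have hp0 : 0 < p := by linarith
  have hpe : ENNReal.ofReal p ≠ 0 := by simpa using hp0
  have hpt : (ENNReal.ofReal p).toReal = p := ENNReal.toReal_ofReal hp0.le
  set N := ∫⁻ t, ‖g t‖ₑ ∂ν with hN
  have hnorm : ∀ f : E → ℂ,
      eLpNorm f (ENNReal.ofReal p) μ = (∫⁻ z, ‖f z‖ₑ ^ p ∂μ) ^ (1 / p) := fun f => by
    rw [eLpNorm_eq_lintegral_rpow_enorm_toReal hpe ENNReal.ofReal_ne_top, hpt]
  have hmeas : ∀ z, Measurable fun t => ‖h t z‖ₑ := fun z =>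
    (hh.comp (measurable_id.prodMk measurable_const)).enorm
  -- Jensen's inequality for the measure `‖g‖ ν` of total mass `N`
  have key : ∀ z, ‖∫ t, g t * h t z ∂ν‖ₑ ^ p ≤
      N ^ (p - 1) * ∫⁻ t, ‖g t‖ₑ * ‖h t z‖ₑ ^ p ∂ν := by
    intro z
    have h1 : ‖∫ t, g t * h t z ∂ν‖ₑ ≤ ∫⁻ t, ‖h t z‖ₑ ∂(ν.withDensity fun t => ‖g t‖ₑ) := by
      refine (enorm_integral_le_lintegral_enorm _).trans_eq ?_
      rw [lintegral_withDensity_eq_lintegral_mul _ hg.enorm (hmeas z)]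
      simp [enorm_mul]
    have h2 := eLpNorm_le_eLpNorm_mul_rpow_measure_univ
      (μ := ν.withDensity fun t => ‖g t‖ₑ) (f := fun t => h t z) (p := 1)
      (q := ENNReal.ofReal p) (by simpa using hp)
      (hh.comp (measurable_id.prodMk measurable_const)).aestronglyMeasurable
    rw [eLpNorm_one_eq_lintegral_enorm,
      eLpNorm_eq_lintegral_rpow_enorm_toReal hpe ENNReal.ofReal_ne_top, hpt,
      lintegral_withDensity_eq_lintegral_mul _ hg.enorm ((hmeas z).pow_const _),
      withDensity_apply _ MeasurableSet.univ, Measure.restrict_univ, ← hN] at h2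
    refine (ENNReal.rpow_le_rpow (h1.trans h2) hp0.le).trans_eq ?_
    rw [ENNReal.mul_rpow_of_nonneg _ _ hp0.le, ← ENNReal.rpow_mul, ← ENNReal.rpow_mul,
      one_div_mul_cancel hp0.ne', ENNReal.rpow_one, mul_comm]
    congr 1
    simp only [ENNReal.toReal_one]
    congr 1
    field_simp
  have hB' : ∀ᵐ t ∂ν, ∫⁻ z, ‖h t z‖ₑ ^ p ∂μ ≤ B ^ p := by
    filter_upwards [hB] with t ht
    rw [hnorm] at ht
    have := ENNReal.rpow_le_rpow ht hp0.le
    rwa [← ENNReal.rpow_mul, one_div_mul_cancel hp0.ne', ENNReal.rpow_one] at this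
  have hjoint : Measurable (Function.uncurry fun z t => ‖g t‖ₑ * ‖h t z‖ₑ ^ p) :=
    (hg.enorm.comp measurable_snd).mul
      (((hh.comp measurable_swap).enorm).pow_const p)
  have total : ∫⁻ z, ‖∫ t, g t * h t z ∂ν‖ₑ ^ p ∂μ ≤ (N * B) ^ p := by
    calc ∫⁻ z, ‖∫ t, g t * h t z ∂ν‖ₑ ^ p ∂μ
        ≤ ∫⁻ z, N ^ (p - 1) * ∫⁻ t, ‖g t‖ₑ * ‖h t z‖ₑ ^ p ∂ν ∂μ := lintegral_mono key
      _ = N ^ (p - 1) * ∫⁻ t, ∫⁻ z, ‖g t‖ₑ * ‖h t z‖ₑ ^ p ∂μ ∂ν := by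
          have hm : Measurable fun z => ∫⁻ t, ‖g t‖ₑ * ‖h t z‖ₑ ^ p ∂ν :=
            hjoint.lintegral_prod_right'
          rw [lintegral_const_mul _ hm, lintegral_lintegral_swap hjoint.aemeasurable]
      _ ≤ N ^ (p - 1) * ∫⁻ t, ‖g t‖ₑ * B ^ p ∂ν := by
          refine mul_le_mul_right (lintegral_mono_ae ?_) _
          filter_upwards [hB'] with t ht
          have hm : Measurable fun z => ‖h t z‖ₑ ^ p :=
            (hh.comp (measurable_const.prodMk measurable_id)).enorm.pow_const p
          rw [lintegral_const_mul _ hm]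
          gcongr
      _ = (N * B) ^ p := by
          rw [lintegral_mul_const _ hg.enorm, ← hN, ← mul_assoc,
            ENNReal.mul_rpow_of_nonneg _ _ hp0.le]
          congr 1
          nth_rewrite 2 [← ENNReal.rpow_one N]
          rw [← ENNReal.rpow_add_of_nonneg _ _ (by linarith) zero_le_one]
          simp
  rw [hnorm]
  refine (ENNReal.rpow_le_rpow total (by positivity)).trans_eq ?_
  rw [← ENNReal.rpow_mul, mul_one_div_cancel hp0.ne', ENNReal.rpow_one]

/-! ### Everywhere convergent power series -/

lemma exists_hasSum_of_entire {f : ℂ → ℂ} (hf : Differentiable ℂ f) :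
    ∃ a : ℕ → ℂ, ∀ z, HasSum (fun n => a n * z ^ n) (f z) := by
  refine ⟨fun n => (n.factorial : ℂ)⁻¹ * iteratedDeriv n f 0, fun z => ?_⟩
  convert! Complex.hasSum_taylorSeries_of_entire hf 0 z using 2
  simp only [smul_eq_mul, sub_zero]; ring

lemma differentiable_of_hasSum {f : ℂ → ℂ} {a : ℕ → ℂ}
    (h : ∀ z, HasSum (fun n => a n * z ^ n) (f z)) : Differentiable ℂ f := by
  intro z
  have hR : DifferentiableOn ℂ f (Metric.ball 0 (‖z‖ + 1)) := by
    have := Complex.differentiableOn_tsum_of_summable_norm (U := Metric.ball (0 : ℂ) (‖z‖ + 1))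
      (F := fun n w => a n * w ^ n) (u := fun n => ‖a n * ((‖z‖ + 1 : ℝ) : ℂ) ^ n‖)
      (h _).summable.norm (fun n => by fun_prop) Metric.isOpen_ball
      (fun n w hw => by
        have hw' : ‖w‖ ≤ ‖z‖ + 1 := by simpa using (Metric.mem_ball.1 hw).le
        rw [norm_mul, norm_mul, norm_pow, norm_pow, Complex.norm_real,
          Real.norm_of_nonneg (by positivity)]
        gcongr)
    exact this.congr fun w _ => (h w).tsum_eq.symm
  exact hR.differentiableAt (Metric.isOpen_ball.mem_nhds (by simp))

lemma integrable_mul_comp_dilation {Ω : Type*} [MeasurableSpace Ω] {ν : Measure Ω} {g φ : Ω → ℂ}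
    (hg : Integrable g ν) (hφ : Measurable φ) (hφ1 : ∀ᵐ t ∂ν, ‖φ t‖ ≤ 1) {f : ℂ → ℂ}
    (hf : Continuous f) (z : ℂ) : Integrable (fun t => g t * f (φ t * z)) ν := by
  obtain ⟨C, hC⟩ := (isCompact_closedBall (0 : ℂ) ‖z‖).exists_bound_of_continuousOn hf.continuousOn
  refine hg.mul_bdd (c := C) (hf.measurable.comp (hφ.mul_const z)).aestronglyMeasurable ?_
  filter_upwards [hφ1] with t ht
  refine hC _ ?_
  simpa using mul_le_mul_of_nonneg_right ht (norm_nonneg z)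

/-- Averaging dilates multiplies the `n`-th Taylor coefficient by the `n`-th moment. -/
lemma hasSum_integral_dilation {Ω : Type*} [MeasurableSpace Ω] {ν : Measure Ω} {g φ : Ω → ℂ}
    (hg : Integrable g ν) (hφ : Measurable φ) (hφ1 : ∀ᵐ t ∂ν, ‖φ t‖ ≤ 1) {f : ℂ → ℂ}
    {a : ℕ → ℂ} (h : ∀ z, HasSum (fun n => a n * z ^ n) (f z)) (z : ℂ) :
    HasSum (fun n => (a n * ∫ t, g t * φ t ^ n ∂ν) * z ^ n) (∫ t, g t * f (φ t * z) ∂ν) := by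
  have hb : ∀ n, ∀ᵐ t ∂ν, ‖φ t ^ n‖ ≤ 1 := fun n => by
    filter_upwards [hφ1] with t ht
    rw [norm_pow]; exact pow_le_one₀ (norm_nonneg _) ht
  have hi : ∀ n, Integrable (fun t => g t * φ t ^ n) ν := fun n =>
    hg.mul_bdd (c := 1) (hφ.pow_const n).aestronglyMeasurable (hb n)
  have := hasSum_integral_of_summable_integral_norm (μ := ν)
    (F := fun n t => (a n * z ^ n) * (g t * φ t ^ n)) (fun n => (hi n).const_mul _) (by
      refine Summable.of_nonneg_of_le (fun n => integral_nonneg fun t => norm_nonneg _)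
        (fun n => ?_) ((h z).summable.norm.mul_right (∫ t, ‖g t‖ ∂ν))
      rw [← integral_const_mul]
      refine integral_mono_ae ((hi n).const_mul _).norm (hg.norm.const_mul _) ?_
      filter_upwards [hb n] with t ht
      rw [norm_mul _ (g t * _), norm_mul (g t)]
      gcongr
      exact mul_le_of_le_one_right (norm_nonneg _) ht)
  convert! this using 1
  · funext n
    rw [integral_const_mul]; ring
  · congr 1
    funext t
    rw [← (h (φ t * z)).tsum_eq, ← tsum_mul_left]
    congr 1; funext n; ring

/-! ### Averages of dilations -/

/-- The generalized Fock norm as an extended nonnegative number, defined for every function: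
`(∫ |f(z)|^p e^{-p α |z|^m} dA(z))^{1/p}`. -/
noncomputable def weightedENorm (p α m : ℝ) (f : ℂ → ℂ) : ℝ≥0∞ :=
  eLpNorm (fun z => (weight α m z : ℂ) * f z) (ENNReal.ofReal p) volume

variable {p α m : ℝ}

lemma weightedENorm_integral_le [hp : Fact (1 ≤ p)] {Ω : Type*} [MeasurableSpace Ω]
    {ν : Measure Ω} [SFinite ν] {g : Ω → ℂ} (hg : Measurable g) {ψ : Ω → ℂ → ℂ}
    (hψ : Measurable (Function.uncurry ψ)) {f : ℂ → ℂ} (hf : Continuous f) {B : ℝ≥0∞}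
    (hB : ∀ᵐ t ∂ν, weightedENorm p α m (fun z => f (ψ t z)) ≤ B) :
    weightedENorm p α m (fun z => ∫ t, g t * f (ψ t z) ∂ν) ≤ (∫⁻ t, ‖g t‖ₑ ∂ν) * B := by
  have h := eLpNorm_integral_mul_le (μ := (volume : Measure ℂ)) hp.out
    (h := fun t z => (weight α m z : ℂ) * f (ψ t z)) hg
    (((Complex.measurable_ofReal.comp (measurable_weight α m)).comp measurable_snd).mul
      (hf.measurable.comp hψ)) hB
  refine le_of_eq_of_le ?_ h
  unfold weightedENorm
  congr 1
  funext z
  rw [← integral_const_mul]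
  congr 1
  funext t
  ring

lemma measurePreserving_rotation {u : ℂ} (hu : ‖u‖ = 1) :
    MeasurePreserving (fun z : ℂ => u * z) :=
  (rotation ⟨u, mem_sphere_zero_iff_norm.2 hu⟩).measurePreserving

/-- The weight is radial, so rotations preserve the norm. -/
lemma weightedENorm_rotation {u : ℂ} (hu : ‖u‖ = 1) {f : ℂ → ℂ} (hf : Continuous f) :
    weightedENorm p α m (fun z => f (u * z)) = weightedENorm p α m f := by
  have h := eLpNorm_comp_measurePreserving (p := ENNReal.ofReal p)
    (g := fun z => (weight α m z : ℂ) * f z)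
    ((Complex.measurable_ofReal.comp (measurable_weight α m)).mul
      hf.measurable).aestronglyMeasurable (measurePreserving_rotation hu)
  rw [weightedENorm, weightedENorm, ← h]
  congr 1
  funext z
  simp [weight, hu]

/-- Dilations by `ζ` in the closed unit disc are contractions: by Poisson's formula
`f (ζ z)` is an average of the rotations `f (e^{iθ} z)`. -/
lemma weightedENorm_dilation_le [hp : Fact (1 ≤ p)] {ζ : ℂ} (hζ : ‖ζ‖ ≤ 1) {f : ℂ → ℂ}
    (hf : Differentiable ℂ f) :
    weightedENorm p α m (fun z => f (ζ * z)) ≤ weightedENorm p α m f := by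
  rcases hζ.eq_or_lt with h1 | h1
  · exact (weightedENorm_rotation h1 hf.continuous).le
  have hne : ∀ θ : ℝ, circleMap 0 1 θ - ζ ≠ 0 := fun θ h => by
    have h' : ‖circleMap 0 1 θ‖ = ‖ζ‖ := by rw [sub_eq_zero.1 h]
    simp at h'
    linarith
  have hball : ζ ∈ Metric.ball (0 : ℂ) 1 := by simpa using h1
  set P : ℝ → ℝ := fun θ => (2 * Real.pi)⁻¹ * poissonKernel 0 ζ (circleMap 0 1 θ) with hP
  have hPc : Continuous P := by
    simp only [hP, poissonKernel, sub_zero]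
    refine continuous_const.mul (Continuous.div (by fun_prop) (by fun_prop) fun θ => ?_)
    simpa using hne θ
  have hP0 : ∀ θ, 0 ≤ P θ := fun θ => by
    simp only [hP, poissonKernel, sub_zero, norm_circleMap_zero, abs_one]
    have : ‖ζ‖ ^ 2 ≤ 1 := pow_le_one₀ (norm_nonneg _) h1.le
    have : 0 ≤ (1 : ℝ) ^ 2 - ‖ζ‖ ^ 2 := by linarith
    positivity
  have poisson : ∀ F : ℂ → ℂ, Differentiable ℂ F →
      ∫ θ in Set.Ioc 0 (2 * Real.pi), (P θ : ℂ) * F (circleMap 0 1 θ) = F ζ := fun F hF => by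
    rw [← hF.diffContOnCl.circleAverage_poissonKernel_smul hball, Real.circleAverage_def,
      intervalIntegral.integral_of_le Real.two_pi_pos.le, ← integral_smul]
    congr 1
    funext θ
    simp [hP, mul_assoc]
  have hmass : ∫⁻ θ in Set.Ioc 0 (2 * Real.pi), ‖(P θ : ℂ)‖ₑ = 1 := by
    -- the formula for the constant function `1` says that the Poisson kernel has mass `1`
    have h := poisson (fun _ => 1) (differentiable_const _)
    simp only [mul_one] at h
    rw [integral_complex_ofReal] at h
    have h' : ∫ θ in Set.Ioc 0 (2 * Real.pi), ‖P θ‖ = 1 := by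
      simp_rw [Real.norm_of_nonneg (hP0 _)]
      exact_mod_cast h
    simp_rw [← ofReal_norm, Complex.norm_real]
    rw [← ofReal_integral_eq_lintegral_ofReal, h', ENNReal.ofReal_one]
    · exact (hPc.norm.integrableOn_Icc).mono_set Set.Ioc_subset_Icc_self
    · exact Eventually.of_forall fun θ => norm_nonneg _
  calc weightedENorm p α m (fun z => f (ζ * z))
      = weightedENorm p α m (fun z => ∫ θ in Set.Ioc 0 (2 * Real.pi),
          (P θ : ℂ) * f (circleMap 0 1 θ * z)) := by
        congr 1
        funext z
        exact (poisson (fun w => f (w * z)) (hf.comp (by fun_prop))).symm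
    _ ≤ (∫⁻ θ in Set.Ioc 0 (2 * Real.pi), ‖(P θ : ℂ)‖ₑ) * weightedENorm p α m f := by
        refine weightedENorm_integral_le (ψ := fun θ z => circleMap 0 1 θ * z)
          (by fun_prop) ?_ hf.continuous (Eventually.of_forall fun θ => ?_)
        · exact Continuous.measurable (by fun_prop)
        · exact (weightedENorm_rotation (by simp) hf.continuous).le
    _ = weightedENorm p α m f := by rw [hmass, one_mul]

end Fock

namespace FockSpace
open Fock
variable {p α m : ℝ} [hp : Fact (1 ≤ p)]

lemma norm_eq_toReal (f : FockSpace p α m) : ‖f‖ = (weightedENorm p α m f).toReal :=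
  norm_eq_toReal_eLpNorm f

lemma weightedENorm_ne_top (f : FockSpace p α m) : weightedENorm p α m f ≠ ⊤ :=
  f.memLp.eLpNorm_ne_top

lemma integrable_of_weightedENorm {f : ℂ → ℂ} (hf : Differentiable ℂ f)
    (h : weightedENorm p α m f ≠ ⊤) : Integrable (density p α m f) :=
  (integrable_density_iff p α m hf).2 ⟨aestronglyMeasurable_weighted α m hf, h.lt_top⟩

/-- A linear operation on entire functions which is bounded for the generalized Fock norm is
realized by a bounded operator. -/
lemma exists_operator {A : (ℂ → ℂ) → ℂ → ℂ} {C : ℝ} (hC : 0 ≤ C)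
    (hd : ∀ f, Differentiable ℂ f → Differentiable ℂ (A f))
    (hadd : ∀ f g, Differentiable ℂ f → Differentiable ℂ g → ∀ z,
      A (fun w => f w + g w) z = A f z + A g z)
    (hsmul : ∀ (c : ℂ) f, Differentiable ℂ f → ∀ z, A (fun w => c * f w) z = c * A f z)
    (hb : ∀ f, Differentiable ℂ f →
      weightedENorm p α m (A f) ≤ ENNReal.ofReal C * weightedENorm p α m f) :
    ∃ T : FockSpace p α m →L[ℂ] FockSpace p α m, IsRealizedBy A T ∧ ‖T‖ ≤ C := by
  have hfin : ∀ f : FockSpace p α m, weightedENorm p α m (A f) ≠ ⊤ := fun f =>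
    ((hb f f.differentiable).trans_lt
      (ENNReal.mul_lt_top ENNReal.ofReal_lt_top f.weightedENorm_ne_top.lt_top)).ne
  let L : FockSpace p α m →ₗ[ℂ] FockSpace p α m :=
    { toFun := fun f => mk (A f) (hd f f.differentiable)
        (integrable_of_weightedENorm (hd f f.differentiable) (hfin f))
      map_add' := fun f g => ext_apply fun z => hadd f g f.differentiable g.differentiable z
      map_smul' := fun c f => ext_apply fun z => hsmul c f f.differentiable z }
  refine ⟨L.mkContinuous C fun f => ?_, fun f z => rfl, L.mkContinuous_norm_le hC _⟩
  rw [norm_eq_toReal, norm_eq_toReal, ← ENNReal.toReal_ofReal hC, ← ENNReal.toReal_mul]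
  exact ENNReal.toReal_mono (ENNReal.mul_ne_top ENNReal.ofReal_ne_top f.weightedENorm_ne_top)
    (hb f f.differentiable)

/-- Averaging the dilations by points `φ t` of the closed unit disc against an integrable density
`g` is a bounded operator of norm at most `∫ |g|`. -/
lemma exists_average_dilation {Ω : Type*} [MeasurableSpace Ω] {ν : Measure Ω} [SFinite ν]
    {g φ : Ω → ℂ} (hgm : Measurable g) (hg : Integrable g ν) (hφ : Measurable φ)
    (hφ1 : ∀ᵐ t ∂ν, ‖φ t‖ ≤ 1) :
    ∃ T : FockSpace p α m →L[ℂ] FockSpace p α m,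
      IsRealizedBy (fun f z => ∫ t, g t * f (φ t * z) ∂ν) T ∧ ‖T‖ ≤ ∫ t, ‖g t‖ ∂ν := by
  refine exists_operator (integral_nonneg fun t => norm_nonneg _) (fun f hf => ?_)
    (fun f f' hf hf' z => ?_) (fun c f hf z => ?_) (fun f hf => ?_)
  · obtain ⟨a, ha⟩ := exists_hasSum_of_entire hf
    exact differentiable_of_hasSum (hasSum_integral_dilation hg hφ hφ1 ha)
  · simp only [mul_add]
    exact integral_add (integrable_mul_comp_dilation hg hφ hφ1 hf.continuous z)
      (integrable_mul_comp_dilation hg hφ hφ1 hf'.continuous z)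
  · rw [← integral_const_mul]
    congr 1
    funext t
    ring
  · rw [ofReal_integral_norm_eq_lintegral_enorm hg]
    refine weightedENorm_integral_le (ψ := fun t z => φ t * z) hgm
      ((hφ.comp measurable_fst).mul measurable_snd) hf.continuous ?_
    filter_upwards [hφ1] with t ht
    exact weightedENorm_dilation_le ht hf

/-! ### Coefficient multipliers -/

/-- The operator `T` multiplies the `n`-th Taylor coefficient at `0` by `c n`. -/
def IsMultiplier (T : FockSpace p α m →L[ℂ] FockSpace p α m) (c : ℕ → ℂ) : Prop :=
  ∀ (f : FockSpace p α m) (a : ℕ → ℂ), (∀ z, HasSum (fun n => a n * z ^ n) (f z)) →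
    ∀ z, HasSum (fun n => (a n * c n) * z ^ n) ((T f) z)

namespace IsMultiplier

variable {S T : FockSpace p α m →L[ℂ] FockSpace p α m} {b c : ℕ → ℂ}

lemma id : IsMultiplier (ContinuousLinearMap.id ℂ (FockSpace p α m)) fun _ => 1 :=
  fun f a h z => by simpa using h z

lemma comp (hS : IsMultiplier S b) (hT : IsMultiplier T c) :
    IsMultiplier (S ∘L T) fun n => c n * b n := fun f a h z => by
  simpa [mul_assoc] using hS (T f) _ (hT f a h) z

lemma add (hS : IsMultiplier S b) (hT : IsMultiplier T c) :
    IsMultiplier (S + T) fun n => b n + c n := fun f a h z => by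
  simpa [mul_add, add_mul, add_apply] using (hS f a h z).add (hT f a h z)

lemma smul (k : ℂ) (hT : IsMultiplier T c) : IsMultiplier (k • T) fun n => k * c n :=
  fun f a h z => by
    change HasSum _ (k * (T f) z)
    simpa [mul_left_comm, mul_assoc] using (hT f a h z).mul_left k

lemma eq_id (hT : IsMultiplier T c) (hc : ∀ n, c n = 1) :
    T = ContinuousLinearMap.id ℂ (FockSpace p α m) := by
  refine ContinuousLinearMap.ext fun f => ext_apply fun z => ?_
  obtain ⟨a, ha⟩ := exists_hasSum_of_entire f.differentiable
  have h := hT f a ha z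
  simp only [hc, mul_one] at h
  exact h.unique (ha z)

lemma of_average {Ω : Type*} [MeasurableSpace Ω] {ν : Measure Ω} {g φ : Ω → ℂ}
    (hg : Integrable g ν) (hφ : Measurable φ) (hφ1 : ∀ᵐ t ∂ν, ‖φ t‖ ≤ 1)
    (hT : IsRealizedBy (fun f z => ∫ t, g t * f (φ t * z) ∂ν) T) :
    IsMultiplier T fun n => ∫ t, g t * φ t ^ n ∂ν := fun f a h z => by
  rw [hT f z]
  exact hasSum_integral_dilation hg hφ hφ1 h z

end IsMultiplier

/-! ### The Hardy operator -/

lemma hardy_eq_average (f : ℂ → ℂ) (z : ℂ) :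
    hardy f z = ∫ t in Set.Ioc (0 : ℝ) 1, 1 * f ((t : ℂ) * z) := by
  rw [hardy]
  split_ifs with hz
  · simp [hz]
  · rw [integration, intervalIntegral.integral_mul_const,
      intervalIntegral.integral_of_le zero_le_one]
    simp only [one_mul]
    field_simp

/-- The Hardy operator is the multiplier with coefficients `1 / (n + 1)`. -/
lemma exists_hardy : ∃ H : FockSpace p α m →L[ℂ] FockSpace p α m,
    IsRealizedBy hardy H ∧ IsMultiplier H fun n => 1 / ((n : ℂ) + 1) := by
  have hg : Integrable (fun _ : ℝ => (1 : ℂ)) (volume.restrict (Set.Ioc 0 1)) :=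
    integrable_const _
  have hφ : Measurable fun t : ℝ => (t : ℂ) := Complex.measurable_ofReal
  have hφ1 : ∀ᵐ t : ℝ ∂volume.restrict (Set.Ioc (0 : ℝ) 1), ‖(t : ℂ)‖ ≤ 1 := by
    filter_upwards [ae_restrict_mem measurableSet_Ioc] with t ht
    rw [Complex.norm_real, Real.norm_of_nonneg ht.1.le]
    exact ht.2
  obtain ⟨H, hH, -⟩ := exists_average_dilation (p := p) (α := α) (m := m)
    measurable_const hg hφ hφ1
  refine ⟨H, fun f z => (hH f z).trans (hardy_eq_average f z).symm, ?_⟩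
  convert! IsMultiplier.of_average hg hφ hφ1 hH using 2 with n
  rw [← intervalIntegral.integral_of_le zero_le_one]
  simp only [one_mul]
  have := integral_pow (a := 0) (b := 1) n
  simp only [← Complex.ofReal_pow]
  rw [intervalIntegral.integral_ofReal, this]
  simp

/-- For `0 < re w`, the multiplier with coefficients `1 / (w + n)` is bounded by `1 / |w|`. With
`u = conj w / |w|` it is the Laplace transform `u ∫₀^∞ e^{-|w| r} f (e^{-u r} z) dr`, which
integrates the dilation semigroup along the ray on which `e^{-w s}` decays fastest. -/
lemma exists_dilation_resolvent {w : ℂ} (hw : 0 < w.re) :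
    ∃ R : FockSpace p α m →L[ℂ] FockSpace p α m,
      IsMultiplier R (fun n => 1 / (w + n)) ∧ ‖R‖ ≤ 1 / ‖w‖ := by
  have hw0 : w ≠ 0 := by rintro rfl; simp at hw
  have hwn : 0 < ‖w‖ := norm_pos_iff.2 hw0
  have hwc : (‖w‖ : ℂ) ≠ 0 := by exact_mod_cast hwn.ne'
  set u : ℂ := (starRingEnd ℂ) w / ‖w‖ with hu
  have hun : ‖u‖ = 1 := by simp [hu, hw0]
  have hure : 0 < u.re := by
    rw [hu, Complex.div_ofReal_re, Complex.conj_re]; positivity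
  have huw : w * u = ‖w‖ := by
    rw [hu, ← mul_div_assoc, Complex.mul_conj, Complex.normSq_eq_norm_sq]
    push_cast
    field_simp
  have hu0 : u ≠ 0 := by rintro h; simp [h] at hun
  set g : ℝ → ℂ := fun r => u * Complex.exp (-‖w‖ * r) with hg
  set φ : ℝ → ℂ := fun r => Complex.exp (-u * r) with hφ
  have hgm : Measurable g := by fun_prop
  have hφm : Measurable φ := by fun_prop
  have hre : ((-‖w‖ : ℂ)).re < 0 := by simpa using hwn
  have hgi : Integrable g (volume.restrict (Set.Ioi 0)) :=
    (integrableOn_exp_mul_complex_Ioi hre 0).const_mul u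
  have hφ1 : ∀ᵐ r ∂volume.restrict (Set.Ioi (0 : ℝ)), ‖φ r‖ ≤ 1 := by
    filter_upwards [ae_restrict_mem measurableSet_Ioi] with r hr
    rw [hφ, Complex.norm_exp]
    have : 0 < u.re * r := mul_pos hure hr
    simpa using this.le
  have hgint : ∫ r in Set.Ioi (0 : ℝ), ‖g r‖ = 1 / ‖w‖ := by
    have : ∀ r : ℝ, ‖g r‖ = Real.exp (-‖w‖ * r) := fun r => by
      simp [hg, hun, Complex.norm_exp]
    simp_rw [this]
    rw [integral_exp_mul_Ioi (by linarith)]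
    simp
  obtain ⟨R, hR, hRn⟩ := exists_average_dilation (p := p) (α := α) (m := m) hgm hgi hφm hφ1
  refine ⟨R, ?_, hRn.trans_eq hgint⟩
  convert! IsMultiplier.of_average hgi hφm hφ1 hR using 2 with n
  have : ∀ r : ℝ, g r * φ r ^ n = u * Complex.exp ((-‖w‖ - n * u) * r) := fun r => by
    simp only [hg, hφ]
    rw [← Complex.exp_nat_mul, mul_assoc, ← Complex.exp_add]
    ring_nf
  simp_rw [this]
  rw [integral_const_mul, integral_exp_mul_complex_Ioi]
  · rw [← huw]
    have h1 : w + n ≠ 0 := fun h => by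
      have := congrArg Complex.re h
      simp at this
      have : (0 : ℝ) ≤ n := n.cast_nonneg
      linarith
    have h2 : -(w * u) - n * u ≠ 0 := by
      rw [show -(w * u) - n * u = -((w + n) * u) by ring]
      exact neg_ne_zero.2 (mul_ne_zero h1 hu0)
    simp only [Complex.ofReal_zero, mul_zero, Complex.exp_zero]
    rw [mul_div_assoc', div_eq_div_iff h1 h2]
    ring
  · have : 0 ≤ n * u.re := by positivity
    simp
    linarith

/-- The resolvent of the Hardy operator is `(H - μ)⁻¹ = -μ⁻¹ (1 + μ⁻¹ R)`, where `R` is the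
multiplier `1 / (w + n)` with `w = 1 - μ⁻¹`. -/
lemma rittCondition_of_isMultiplier_hardy {H : FockSpace p α m →L[ℂ] FockSpace p α m}
    (hH : IsMultiplier H fun n => 1 / ((n : ℂ) + 1)) : RittCondition H := by
  refine ⟨3, by norm_num, fun μ hμ => ?_⟩
  have hμ0 : μ ≠ 0 := by rintro rfl; simp at hμ; linarith
  have hμ1 : μ - 1 ≠ 0 := fun h => by rw [sub_eq_zero.1 h] at hμ; simp at hμ
  have hinv : ‖μ⁻¹‖ < 1 := by rw [norm_inv]; exact inv_lt_one_of_one_lt₀ hμ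
  have hw : 0 < (1 - μ⁻¹).re := by
    have := (Complex.re_le_norm μ⁻¹).trans_lt hinv
    simpa using this
  obtain ⟨R, hR, hRn⟩ := exists_dilation_resolvent (p := p) (α := α) (m := m) hw
  have hn : ∀ n : ℕ, (1 - μ⁻¹ + n) ≠ 0 := fun n h => by
    have := congrArg Complex.re h
    have h0 : (0 : ℝ) ≤ n := n.cast_nonneg
    simp only [Complex.add_re, Complex.natCast_re, Complex.zero_re] at this
    linarith
  have hn' : ∀ n : ℕ, μ * ((n : ℂ) + 1) - 1 ≠ 0 := fun n => by
    have := mul_ne_zero hμ0 (hn n)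
    rwa [mul_add, mul_sub, mul_inv_cancel₀ hμ0,
      show μ * 1 - 1 + μ * n = μ * ((n : ℂ) + 1) - 1 by ring] at this
  have hA : IsMultiplier (H - μ • ContinuousLinearMap.id ℂ (FockSpace p α m))
      fun n => 1 / ((n : ℂ) + 1) + -μ * 1 := by
    rw [sub_eq_add_neg, ← neg_smul]
    exact hH.add (IsMultiplier.id.smul (-μ))
  have hB := (IsMultiplier.id.add (hR.smul μ⁻¹)).smul (-μ⁻¹)
  have hcalc : ∀ n : ℕ, (1 / ((n : ℂ) + 1) + -μ * 1) *
      (-μ⁻¹ * (1 + μ⁻¹ * (1 / (1 - μ⁻¹ + n)))) = 1 := fun n => by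
    have h1 : (n : ℂ) + 1 ≠ 0 := n.cast_add_one_ne_zero
    have h2 : 1 - μ⁻¹ + n = (μ * ((n : ℂ) + 1) - 1) / μ := by field_simp; ring
    rw [h2]
    have h3 := hn' n
    have h4 : (n : ℂ) + 1 = (μ * ((n : ℂ) + 1) - 1 + 1) / μ := by field_simp; ring
    have h5 : μ * ((n : ℂ) + 1) - 1 + 1 ≠ 0 := by
      rw [sub_add_cancel]; exact mul_ne_zero hμ0 h1
    generalize μ * ((n : ℂ) + 1) - 1 = d at h3 h4 h5 ⊢
    rw [h4]
    field_simp
    ring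
  refine ⟨_, (hA.comp hB).eq_id fun n => ?_, (hB.comp hA).eq_id fun n => ?_, ?_⟩
  · rw [mul_comm]; exact hcalc n
  · exact hcalc n
  · have h1 : ‖ContinuousLinearMap.id ℂ (FockSpace p α m) + μ⁻¹ • R‖ ≤
        1 + ‖μ‖⁻¹ * (1 / ‖1 - μ⁻¹‖) := by
      refine (norm_add_le _ _).trans (add_le_add ContinuousLinearMap.norm_id_le ?_)
      rw [norm_smul, norm_inv]
      gcongr
    have h2 : ‖1 - μ⁻¹‖ = ‖μ - 1‖ / ‖μ‖ := by
      rw [← norm_div]; congr 1; field_simp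
    have h3 : ‖μ - 1‖ ≤ ‖μ‖ + 1 := by simpa using norm_sub_le μ 1
    have hpos : 0 < ‖μ - 1‖ := norm_pos_iff.2 hμ1
    rw [norm_smul, norm_neg, norm_inv]
    refine (mul_le_mul_of_nonneg_left h1 (by positivity)).trans ?_
    rw [h2]
    have hμp : 0 < ‖μ‖ := by linarith
    have : ‖μ‖⁻¹ * (1 + ‖μ‖⁻¹ * (1 / (‖μ - 1‖ / ‖μ‖))) = (‖μ - 1‖ + 1) / ‖μ‖ / ‖μ - 1‖ := by
      field_simp
    rw [this]
    gcongr
    rw [div_le_iff₀ hμp]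
    linarith

end FockSpace

namespace Fock

/-! ### Operators with summable powers -/

section SummablePowers

variable {X : Type*} [NormedAddCommGroup X] [NormedSpace ℂ X] {T : X →L[ℂ] X}

lemma powerBounded_of_summable (h : Summable fun n => ‖T ^ n‖) : PowerBounded T :=
  ⟨∑' n, ‖T ^ n‖ + 1, by positivity, fun n =>
    (h.le_tsum n fun _ _ => norm_nonneg _).trans (by linarith)⟩

lemma uniformlyMeanErgodic_of_summable (h : Summable fun n => ‖T ^ n‖) :
    UniformlyMeanErgodic T := by
  refine ⟨0, squeeze_zero_norm (a := fun n : ℕ => (∑' k, ‖T ^ k‖) / n) (fun n => ?_)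
    (tendsto_const_div_atTop_nhds_zero_nat _)⟩
  rw [norm_smul, norm_div, norm_one, Complex.norm_natCast, one_div, inv_mul_eq_div]
  gcongr
  exact (norm_sum_le _ _).trans (h.sum_le_tsum _ fun _ _ => norm_nonneg _)

/-- The Neumann series `-∑ μ^{-(n+1)} T^n` converges on `|μ| > 1`, with norm at most
`(∑ ‖T^n‖) / |μ|`. -/
lemma rittCondition_of_summable [CompleteSpace X] (h : Summable fun n => ‖T ^ n‖) :
    RittCondition T := by
  refine ⟨2 * (∑' n, ‖T ^ n‖) + 1, by positivity, fun μ hμ => ?_⟩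
  have hμp : 0 < ‖μ‖ := by linarith
  have hμ0 : μ ≠ 0 := norm_pos_iff.1 hμp
  have hμ1 : 0 < ‖μ - 1‖ := norm_pos_iff.2 fun h => by
    rw [sub_eq_zero.1 h] at hμ; simp at hμ
  have hle : ∀ n, ‖(μ⁻¹ • T) ^ n‖ ≤ ‖T ^ n‖ := fun n => by
    rw [smul_pow, norm_smul, norm_pow, norm_inv]
    exact mul_le_of_le_one_left (norm_nonneg _)
      (pow_le_one₀ (by positivity) (inv_le_one_of_one_le₀ hμ.le))
  have hsn : Summable fun n => ‖(μ⁻¹ • T) ^ n‖ :=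
    h.of_nonneg_of_le (fun _ => norm_nonneg _) hle
  have hs : Summable fun n => (μ⁻¹ • T) ^ n := hsn.of_norm
  have hT : T - μ • ContinuousLinearMap.id ℂ X = -μ • (1 - μ⁻¹ • T) := by
    rw [smul_sub, smul_smul, neg_mul, mul_inv_cancel₀ hμ0, neg_smul, neg_smul, one_smul]
    rw [ContinuousLinearMap.one_def]
    abel
  refine ⟨-μ⁻¹ • ∑' n, (μ⁻¹ • T) ^ n, ?_, ?_, ?_⟩
  · rw [hT]
    change (-μ • (1 - μ⁻¹ • T)) * (-μ⁻¹ • ∑' n, (μ⁻¹ • T) ^ n) = 1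
    rw [smul_mul_smul_comm, hs.one_sub_mul_tsum_pow, neg_mul_neg, mul_inv_cancel₀ hμ0, one_smul]
  · rw [hT]
    change (-μ⁻¹ • ∑' n, (μ⁻¹ • T) ^ n) * (-μ • (1 - μ⁻¹ • T)) = 1
    rw [smul_mul_smul_comm, hs.tsum_pow_mul_one_sub, neg_mul_neg, inv_mul_cancel₀ hμ0, one_smul]
  · have h1 : ‖∑' n, (μ⁻¹ • T) ^ n‖ ≤ ∑' n, ‖T ^ n‖ :=
      (norm_tsum_le_tsum_norm hsn).trans (hsn.tsum_le_tsum hle h)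
    have h2 : ‖μ - 1‖ ≤ 2 * ‖μ‖ := by
      have : ‖μ - 1‖ ≤ ‖μ‖ + 1 := by simpa using norm_sub_le μ 1
      linarith
    have h0 : 0 ≤ ∑' n, ‖T ^ n‖ := tsum_nonneg fun _ => norm_nonneg _
    rw [norm_smul, norm_neg, norm_inv, le_div_iff₀ hμ1]
    calc ‖μ‖⁻¹ * ‖∑' n, (μ⁻¹ • T) ^ n‖ * ‖μ - 1‖
        ≤ ‖μ‖⁻¹ * (∑' n, ‖T ^ n‖) * (2 * ‖μ‖) := by gcongr
      _ = 2 * ∑' n, ‖T ^ n‖ := by field_simp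
      _ ≤ _ := by linarith

end SummablePowers

/-! ### Operators with the open unit disc in the point spectrum -/

section Eigenvalues

variable {X : Type*} [NormedAddCommGroup X] [NormedSpace ℂ X] {T : X →L[ℂ] X}

lemma norm_le_opNorm_of_eigenvector {S : X →L[ℂ] X} {k : ℂ} {x : X} (hx : x ≠ 0)
    (h : S x = k • x) : ‖k‖ ≤ ‖S‖ := by
  have h' := S.le_opNorm x
  rw [h, norm_smul] at h'
  exact le_of_mul_le_mul_right h' (norm_pos_iff.2 hx)

/-- Ritt's condition bounds the resolvent at points outside the unit disc near `-1`, which is a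
limit of eigenvalues. -/
lemma not_rittCondition_of_eigenvalues
    (h : ∀ l : ℂ, ‖l‖ < 1 → ∃ x : X, x ≠ 0 ∧ T x = l • x) : ¬ RittCondition T := by
  rintro ⟨C, hC, hR⟩
  set ε : ℝ := 1 / (C + 2) with hε
  have hε0 : 0 < ε := by positivity
  have hε1 : ε < 1 := by rw [hε, div_lt_one (by positivity)]; linarith
  -- the resolvent at `-(1 + ε)` has norm at least `1 / (2 ε)`, against the bound `C / (2 + ε)`
  obtain ⟨x, hx, hTx⟩ := h (-((1 - ε : ℝ) : ℂ)) (by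
    rw [norm_neg, Complex.norm_real, Real.norm_of_nonneg (by linarith)]; linarith)
  obtain ⟨R, -, hR2, hR3⟩ := hR (-((1 + ε : ℝ) : ℂ)) (by
    rw [norm_neg, Complex.norm_real, Real.norm_of_nonneg (by linarith)]; linarith)
  have h1 : ((2 * ε : ℝ) : ℂ) • R x = x := by
    have h := congrArg (fun S : X →L[ℂ] X => S x) hR2
    simp only [ContinuousLinearMap.comp_apply, sub_apply, hTx, smul_apply,
      ContinuousLinearMap.id_apply, ← sub_smul, map_smul] at h
    convert! h using 2
    push_cast
    ring
  have h2 : R x = (((2 * ε)⁻¹ : ℝ) : ℂ) • x := by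
    rw [Complex.ofReal_inv, eq_inv_smul_iff₀ (by exact_mod_cast (by positivity : 2 * ε ≠ 0)), h1]
  have h3 := (norm_le_opNorm_of_eigenvector hx h2).trans hR3
  have h4 : ‖-((1 + ε : ℝ) : ℂ) - 1‖ = 2 + ε := by
    rw [show -((1 + ε : ℝ) : ℂ) - 1 = -((2 + ε : ℝ) : ℂ) by push_cast; ring, norm_neg,
      Complex.norm_real, Real.norm_of_nonneg (by linarith)]
  rw [h4, Complex.norm_real, Real.norm_of_nonneg (by positivity), le_div_iff₀ (by linarith),
    inv_mul_le_iff₀ (by positivity)] at h3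
  have h5 : ε * (C + 2) = 1 := by rw [hε]; field_simp
  nlinarith

/-- The limit `P` of the means `A n` vanishes on each eigenvector with `|l| < 1`, so `‖A n - P‖` is
at least `|1/n ∑ l^k|` for every such `l`; as `l` tends to `1` this bound tends to `1`. -/
lemma not_uniformlyMeanErgodic_of_eigenvalues
    (h : ∀ l : ℂ, ‖l‖ < 1 → ∃ x : X, x ≠ 0 ∧ T x = l • x) : ¬ UniformlyMeanErgodic T := by
  rintro ⟨P, hP⟩
  set A : ℕ → X →L[ℂ] X := fun n => (1 / (n : ℂ)) • ∑ k ∈ Finset.Icc 1 n, T ^ k with hA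
  set a : ℕ → ℂ → ℂ := fun n l => (1 / (n : ℂ)) * ∑ k ∈ Finset.Icc 1 n, l ^ k with ha
  have hpow : ∀ (l : ℂ) (x : X), T x = l • x → ∀ k : ℕ, (T ^ k) x = l ^ k • x := by
    intro l x hx k
    induction k with
    | zero => simp
    | succ k ih =>
      rw [pow_succ, mul_apply_eq_comp, hx, map_smul, ih, smul_smul, pow_succ, mul_comm]
  have hAx : ∀ (l : ℂ) (x : X), T x = l • x → ∀ n, A n x = a n l • x := by
    intro l x hx n
    simp only [hA, ha, smul_apply, sum_apply,
      hpow l x hx, ← Finset.sum_smul, smul_smul]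
  have hlim : ∀ l : ℂ, ‖l‖ < 1 → Tendsto (fun n => a n l) atTop (𝓝 0) := by
    intro l hl
    have hs : Summable fun k : ℕ => ‖l‖ ^ k := summable_geometric_of_lt_one (norm_nonneg _) hl
    refine squeeze_zero_norm (a := fun n : ℕ => (∑' k : ℕ, ‖l‖ ^ k) / n) (fun n => ?_)
      (tendsto_const_div_atTop_nhds_zero_nat _)
    rw [norm_mul, norm_div, norm_one, Complex.norm_natCast, one_div, inv_mul_eq_div]
    gcongr
    refine (norm_sum_le _ _).trans ?_
    simp_rw [norm_pow]
    exact hs.sum_le_tsum _ fun _ _ => by positivity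
  have hPx : ∀ (l : ℂ) (x : X), ‖l‖ < 1 → T x = l • x → P x = 0 := by
    intro l x hl hx
    have h1 : Tendsto (fun n => A n x) atTop (𝓝 (P x)) :=
      ((ContinuousLinearMap.apply ℂ X x).continuous.tendsto P).comp hP
    have h2 : Tendsto (fun n => a n l • x) atTop (𝓝 ((0 : ℂ) • x)) := (hlim l hl).smul_const x
    rw [zero_smul] at h2
    refine tendsto_nhds_unique h1 (h2.congr fun n => (hAx l x hx n).symm)
  have hbound : ∀ n (l : ℂ), ‖l‖ < 1 → ‖a n l‖ ≤ ‖A n - P‖ := by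
    intro n l hl
    obtain ⟨x, hx, hTx⟩ := h l hl
    refine norm_le_opNorm_of_eigenvector hx ?_
    rw [sub_apply, hPx l x hl hTx, sub_zero, hAx l x hTx]
  have hone : ∀ n : ℕ, n ≠ 0 → 1 ≤ ‖A n - P‖ := by
    intro n hn
    have hc : Tendsto (fun t : ℝ => ‖a n t‖) (𝓝[<] 1) (𝓝 ‖a n ((1 : ℝ) : ℂ)‖) := by
      have : Continuous fun t : ℝ => ‖a n t‖ := by simp only [ha]; fun_prop
      exact (this.tendsto 1).mono_left nhdsWithin_le_nhds
    have h1 : a n ((1 : ℝ) : ℂ) = 1 := by simp [ha, hn]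
    rw [h1, norm_one] at hc
    refine le_of_tendsto hc ?_
    filter_upwards [Ioo_mem_nhdsLT (zero_lt_one (α := ℝ))] with t ht
    refine hbound n t ?_
    rw [Complex.norm_real, Real.norm_of_nonneg ht.1.le]
    exact ht.2
  have hz : Tendsto (fun n => ‖A n - P‖) atTop (𝓝 0) := by
    simpa using (tendsto_iff_norm_sub_tendsto_zero.1 hP)
  have := ge_of_tendsto hz ((eventually_ne_atTop 0).mono hone)
  linarith

end Eigenvalues

variable {p α m : ℝ}

/-! ### Translations and derivatives for `m ≤ 1` -/

/-- For `m ≤ 1` the function `|z|^m` is subadditive, so translations are bounded. -/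
lemma weightedENorm_translate_le (hα : 0 ≤ α) (hm : 0 ≤ m) (hm1 : m ≤ 1) {f : ℂ → ℂ}
    (hf : Continuous f) (w : ℂ) :
    weightedENorm p α m (fun z => f (z + w)) ≤
      ENNReal.ofReal (Real.exp (α * ‖w‖ ^ m)) * weightedENorm p α m f := by
  have h1 := eLpNorm_comp_measurePreserving (p := ENNReal.ofReal p)
    (g := fun z => (weight α m z : ℂ) * f z)
    ((Complex.measurable_ofReal.comp (measurable_weight α m)).mul
      hf.measurable).aestronglyMeasurable (measurePreserving_add_right volume w)
  rw [weightedENorm, weightedENorm, ← h1]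
  refine eLpNorm_le_mul_eLpNorm_of_ae_le_mul (Eventually.of_forall fun z => ?_) _
  have hw : weight α m z ≤ Real.exp (α * ‖w‖ ^ m) * weight α m (z + w) := by
    rw [weight, weight, ← Real.exp_add]
    refine Real.exp_le_exp.2 ?_
    have h2 : ‖z + w‖ ^ m ≤ ‖z‖ ^ m + ‖w‖ ^ m :=
      (Real.rpow_le_rpow (norm_nonneg _) (norm_add_le z w) hm).trans
        (Real.rpow_add_le_add_rpow (norm_nonneg _) (norm_nonneg _) hm hm1)
    have := mul_le_mul_of_nonneg_left h2 hα
    linarith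
  have hpos : ∀ z, 0 ≤ weight α m z := fun z => (Real.exp_pos _).le
  simp only [Function.comp_apply, norm_mul, Complex.norm_real, Real.norm_of_nonneg (hpos _)]
  rw [← mul_assoc]
  gcongr

lemma iteratedDeriv_eq_integral {f : ℂ → ℂ} (hf : Differentiable ℂ f) (n : ℕ) {R : ℝ}
    (hR : 0 < R) (z : ℂ) :
    iteratedDeriv n f z = ∫ θ in Set.Ioc 0 (2 * Real.pi),
      ((2 * Real.pi)⁻¹ * n.factorial / circleMap 0 R θ ^ n : ℂ) * f (z + circleMap 0 R θ) := by
  have h := hf.differentiableOn.circleIntegral_one_div_sub_center_pow_smul (c := z) hR n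
  have hn : (n.factorial : ℂ) ≠ 0 := by exact_mod_cast n.factorial_ne_zero
  have hpi : (Real.pi : ℂ) ≠ 0 := by exact_mod_cast Real.pi_ne_zero
  have h' : iteratedDeriv n f z = (n.factorial / (2 * Real.pi * Complex.I) : ℂ) *
      ∮ w in C(z, R), (1 / (w - z) ^ (n + 1)) • f w := by
    rw [h, smul_eq_mul]
    field_simp [Complex.I_ne_zero]
  rw [h', circleIntegral, intervalIntegral.integral_of_le Real.two_pi_pos.le,
    ← integral_const_mul]
  congr 1
  funext θ
  have hc : circleMap 0 R θ ≠ 0 := circleMap_ne_center hR.ne'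
  rw [deriv_circleMap, circleMap_sub_center, show circleMap z R θ = z + circleMap 0 R θ by
    simp [circleMap]]
  simp only [smul_eq_mul]
  push_cast
  field_simp [Complex.I_ne_zero]
  ring

/-- Cauchy's formula writes the `n`-th derivative as `n! / R^n` times an average of the
translates by points of the circle of radius `R`. -/
lemma weightedENorm_iteratedDeriv_le [hp : Fact (1 ≤ p)] (hα : 0 ≤ α) (hm : 0 ≤ m) (hm1 : m ≤ 1)
    {f : ℂ → ℂ} (hf : Differentiable ℂ f) (n : ℕ) {R : ℝ} (hR : 0 < R) :
    weightedENorm p α m (iteratedDeriv n f) ≤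
      ENNReal.ofReal (n.factorial / R ^ n * Real.exp (α * R ^ m)) * weightedENorm p α m f := by
  have h := weightedENorm_integral_le (p := p) (α := α) (m := m)
    (ν := volume.restrict (Set.Ioc 0 (2 * Real.pi)))
    (g := fun θ => ((2 * Real.pi)⁻¹ * n.factorial / circleMap 0 R θ ^ n : ℂ))
    (ψ := fun θ z => z + circleMap 0 R θ)
    (B := ENNReal.ofReal (Real.exp (α * R ^ m)) * weightedENorm p α m f)
    (measurable_const.div ((continuous_circleMap 0 R).measurable.pow_const n))
    (Continuous.measurable (by fun_prop)) hf.continuous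
    (Eventually.of_forall fun θ => by
      have := weightedENorm_translate_le (p := p) hα hm hm1 hf.continuous (circleMap 0 R θ)
      rwa [norm_circleMap_zero, abs_of_pos hR] at this)
  have hg : ∀ θ, ‖((2 * Real.pi)⁻¹ * n.factorial / circleMap 0 R θ ^ n : ℂ)‖ₑ =
      ENNReal.ofReal ((2 * Real.pi)⁻¹ * (n.factorial / R ^ n)) := fun θ => by
    rw [← ofReal_norm]
    congr 1
    simp [abs_of_pos hR, abs_of_pos Real.pi_pos, mul_div_assoc]
  simp_rw [hg] at h
  rw [lintegral_const, Measure.restrict_apply MeasurableSet.univ, Set.univ_inter,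
    Real.volume_Ioc, sub_zero, ← ENNReal.ofReal_mul (by positivity), ← mul_assoc,
    ← ENNReal.ofReal_mul (by positivity)] at h
  have hfun : iteratedDeriv n f = fun z => ∫ θ in Set.Ioc 0 (2 * Real.pi),
      ((2 * Real.pi)⁻¹ * n.factorial / circleMap 0 R θ ^ n : ℂ) * f (z + circleMap 0 R θ) :=
    funext fun z => iteratedDeriv_eq_integral hf n hR z
  rw [hfun]
  convert! h using 3
  have := Real.pi_pos
  field_simp

lemma weightedENorm_const_mul (c : ℂ) (f : ℂ → ℂ) :
    weightedENorm p α m (fun z => c * f z) = ‖c‖ₑ * weightedENorm p α m f := by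
  rw [weightedENorm, weightedENorm, ← eLpNorm_const_smul]
  congr 1
  funext z
  simp only [Pi.smul_apply, smul_eq_mul]
  ring

lemma weightedENorm_one_ne_zero [hp : Fact (1 ≤ p)] :
    weightedENorm p α m (fun _ => 1) ≠ 0 := by
  rw [weightedENorm, Ne, eLpNorm_eq_zero_iff
    (aestronglyMeasurable_weighted α m (differentiable_const _)) (exponent_ne_zero p)]
  intro h
  obtain ⟨z, hz⟩ := h.exists
  simp [weight] at hz

end Fock

namespace FockSpace
open Fock
variable {p α m : ℝ} [hp : Fact (1 ≤ p)]

/-! ### Completeness for `m ≤ 1` -/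

/-- Point evaluations are bounded: translate the point to `0`, where evaluation is the dilation
by the factor `0`. -/
lemma exists_norm_apply_le (hα : 0 ≤ α) (hm : 0 ≤ m) (hm1 : m ≤ 1) :
    ∃ K : ℝ, 0 ≤ K ∧ ∀ (f : FockSpace p α m) (w : ℂ),
      ‖f w‖ ≤ K * Real.exp (α * ‖w‖ ^ m) * ‖f‖ := by
  set c := weightedENorm p α m (fun _ => 1)
  have hc : c ≠ 0 := weightedENorm_one_ne_zero
  refine ⟨(c⁻¹).toReal, ENNReal.toReal_nonneg, fun f w => ?_⟩
  have h1 := weightedENorm_dilation_le (p := p) (α := α) (m := m) (ζ := 0) (by simp)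
    (f := fun z => f (z + w)) (f.differentiable.comp (by fun_prop))
  have h2 := h1.trans (weightedENorm_translate_le hα hm hm1 f.differentiable.continuous w)
  have h3 : weightedENorm p α m (fun z => f (0 * z + w)) = ‖f w‖ₑ * c := by
    rw [← weightedENorm_const_mul]
    simp
  have hfin : ENNReal.ofReal (Real.exp (α * ‖w‖ ^ m)) * weightedENorm p α m f ≠ ⊤ :=
    ENNReal.mul_ne_top ENNReal.ofReal_ne_top f.weightedENorm_ne_top
  rw [h3, ← ENNReal.le_div_iff_mul_le (Or.inl hc) (Or.inr hfin), div_eq_mul_inv, mul_comm] at h2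
  have h4 := ENNReal.toReal_mono (ENNReal.mul_ne_top (ENNReal.inv_ne_top.2 hc) hfin) h2
  rwa [toReal_enorm, ENNReal.toReal_mul, ENNReal.toReal_mul,
    ENNReal.toReal_ofReal (Real.exp_pos _).le, ← norm_eq_toReal, ← mul_assoc] at h4

/-- Fatou's lemma: the ball of radius `C` is closed under pointwise limits. -/
lemma weightedENorm_le_of_tendsto {v : ℕ → FockSpace p α m} {F : ℂ → ℂ} {C : ℝ}
    (hF : ∀ z, Tendsto (fun n => v n z) atTop (𝓝 (F z))) (hC : ∀ n, ‖v n‖ ≤ C) :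
    weightedENorm p α m F ≤ ENNReal.ofReal C := by
  have h := Lp.eLpNorm_lim_le_liminf_eLpNorm (p := ENNReal.ofReal p) (μ := (volume : Measure ℂ))
    (f := fun n z => (weight α m z : ℂ) * v n z)
    (fun n => aestronglyMeasurable_weighted α m (v n).differentiable)
    (fun z => (weight α m z : ℂ) * F z)
    (Eventually.of_forall fun z => (hF z).const_mul _)
  refine h.trans (liminf_le_of_frequently_le' (Frequently.of_forall fun n => ?_))
  change weightedENorm p α m (v n) ≤ _
  rw [← ENNReal.ofReal_toReal (v n).weightedENorm_ne_top, ← norm_eq_toReal]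
  exact ENNReal.ofReal_le_ofReal (hC n)

lemma sum_apply {ι : Type*} (s : Finset ι) (v : ι → FockSpace p α m) (z : ℂ) :
    (∑ i ∈ s, v i) z = ∑ i ∈ s, v i z := by
  classical
  induction s using Finset.induction_on with
  | empty => simp [zero_apply]
  | insert a s ha ih => rw [Finset.sum_insert ha, Finset.sum_insert ha, add_apply, ih]

lemma completeSpace (hα : 0 ≤ α) (hm : 0 ≤ m) (hm1 : m ≤ 1) :
    CompleteSpace (FockSpace p α m) := by
  refine NormedAddCommGroup.completeSpace_of_summable_imp_tendsto fun u hu => ?_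
  obtain ⟨K, hK, hb⟩ := exists_norm_apply_le (p := p) hα hm hm1
  have hsum : ∀ z, Summable fun n => u n z := fun z =>
    Summable.of_norm_bounded (hu.mul_left (K * Real.exp (α * ‖z‖ ^ m))) fun n => hb (u n) z
  set F : ℂ → ℂ := fun z => ∑' n, u n z
  have hd : Differentiable ℂ F := fun z => by
    have : DifferentiableOn ℂ F (Metric.ball 0 (‖z‖ + 1)) := by
      refine Complex.differentiableOn_tsum_of_summable_norm
        (hu.mul_left (K * Real.exp (α * (‖z‖ + 1) ^ m)))
        (fun n => (u n).differentiable.differentiableOn) Metric.isOpen_ball fun n w hw => ?_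
      have hw' : ‖w‖ ≤ ‖z‖ + 1 := by simpa using (Metric.mem_ball.1 hw).le
      refine (hb (u n) w).trans ?_
      gcongr
    exact this.differentiableAt (Metric.isOpen_ball.mem_nhds (by simp))
  have htail : ∀ N, weightedENorm p α m (fun z => F z - (∑ i ∈ Finset.range N, u i) z) ≤
      ENNReal.ofReal (∑' n, ‖u (n + N)‖) := fun N => by
    refine weightedENorm_le_of_tendsto (v := fun M => ∑ i ∈ Finset.range M, u (i + N))
      (fun z => ?_) (fun M => ?_)
    · simp_rw [sum_apply]
      rw [show F z = ∑' n, u n z from rfl, ← (hsum z).sum_add_tsum_nat_add N, add_sub_cancel_left]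
      exact ((summable_nat_add_iff N).2 (hsum z)).hasSum.tendsto_sum_nat
    · exact (norm_sum_le _ _).trans
        (((summable_nat_add_iff N).2 hu).sum_le_tsum _ fun _ _ => norm_nonneg _)
  have h0 := htail 0
  simp only [Finset.range_zero, Finset.sum_empty, zero_apply, sub_zero] at h0
  refine ⟨mk F hd (integrable_of_weightedENorm hd (h0.trans_lt ENNReal.ofReal_lt_top).ne), ?_⟩
  rw [tendsto_iff_norm_sub_tendsto_zero]
  refine squeeze_zero (fun _ => norm_nonneg _) (fun N => ?_) (tendsto_sum_nat_add fun n => ‖u n‖)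
  rw [norm_sub_rev, norm_eq_toReal]
  have h := ENNReal.toReal_mono ENNReal.ofReal_ne_top (htail N)
  rw [ENNReal.toReal_ofReal (tsum_nonneg fun _ => norm_nonneg _)] at h
  refine le_of_eq_of_le ?_ h
  congr 2

/-! ### The differentiation operator -/

/-- For `m ≤ 1`, differentiation is bounded. Its powers obey `‖D^n‖ ≤ n! R^{-n} e^{α R^m}` for
every radius `R`. -/
lemma exists_deriv (hα : 0 ≤ α) (hm : 0 ≤ m) (hm1 : m ≤ 1) :
    ∃ D : FockSpace p α m →L[ℂ] FockSpace p α m, IsRealizedBy deriv D ∧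
      ∀ (n : ℕ) (R : ℝ), 0 < R → ‖D ^ n‖ ≤ n.factorial / R ^ n * Real.exp (α * R ^ m) := by
  obtain ⟨D, hD, -⟩ := exists_operator (p := p) (α := α) (m := m) (A := deriv)
    (Real.exp_pos α).le (fun f hf => hf.deriv)
    (fun f g hf hg z => deriv_fun_add hf.differentiableAt hg.differentiableAt)
    (fun c f hf z => deriv_const_mul c hf.differentiableAt)
    (fun f hf => by
      simpa using weightedENorm_iteratedDeriv_le (p := p) hα hm hm1 hf 1 one_pos)
  have hpow : ∀ (n : ℕ) (f : FockSpace p α m), ((D ^ n) f).toFun = iteratedDeriv n f := by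
    intro n
    induction n with
    | zero => intro f; simp
    | succ n ih =>
      intro f
      rw [pow_succ, mul_apply_eq_comp, ih, iteratedDeriv_succ']
      congr 1
      exact funext (hD f)
  refine ⟨D, hD, fun n R hR => ContinuousLinearMap.opNorm_le_bound _ (by positivity) fun f => ?_⟩
  have h := weightedENorm_iteratedDeriv_le (p := p) hα hm hm1 f.differentiable n hR
  rw [norm_eq_toReal, norm_eq_toReal, hpow]
  rw [← ENNReal.toReal_ofReal (r := n.factorial / R ^ n * Real.exp (α * R ^ m)) (by positivity),
    ← ENNReal.toReal_mul]
  exact ENNReal.toReal_mono (ENNReal.mul_ne_top ENNReal.ofReal_ne_top f.weightedENorm_ne_top) h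

end FockSpace

namespace Fock

/-- The exponent `α r^m` of the weight is at most linear, with slope less than `1`. -/
lemma exists_mul_rpow_le {α m : ℝ} (hα : 0 < α) (hm : 0 < m) (h : m < 1 ∨ (m = 1 ∧ α < 1)) :
    ∃ β C : ℝ, 0 < β ∧ β < 1 ∧ ∀ r : ℝ, 0 ≤ r → α * r ^ m ≤ β * r + C := by
  rcases h with h | ⟨rfl, h⟩
  · refine ⟨1 / 2, α * ((2 * α) ^ (1 - m)⁻¹) ^ m, by norm_num, by norm_num, fun r hr => ?_⟩
    -- beyond the radius `s`, where `s ^ (1 - m) = 2 α`, the power is at most `r / 2`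
    set s := (2 * α) ^ (1 - m)⁻¹ with hs
    have hs0 : 0 < s := by positivity
    rcases le_total r s with hrs | hrs
    · have : α * r ^ m ≤ α * s ^ m := by gcongr
      linarith
    · have hr0 : 0 < r := hs0.trans_le hrs
      have h1 : 2 * α ≤ r ^ (1 - m) := by
        have : s ^ (1 - m) = 2 * α := by
          rw [hs, ← Real.rpow_mul (by positivity), inv_mul_cancel₀ (by linarith), Real.rpow_one]
        rw [← this]
        exact Real.rpow_le_rpow hs0.le hrs (by linarith)
      have h2 : r ^ (1 - m) * r ^ m = r := by
        rw [← Real.rpow_add hr0]; simp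
      have h3 : 2 * α * r ^ m ≤ r := (mul_le_mul_of_nonneg_right h1 (by positivity)).trans_eq h2
      have : 0 ≤ α * s ^ m := by positivity
      linarith
  · exact ⟨α, 0, hα, h, fun r _ => by simp⟩

/-- With the radius `n / β`, Stirling's formula bounds the terms by a multiple of `n β^n`. -/
lemma summable_of_le_factorial {b : ℕ → ℝ} {β K : ℝ} (hβ : 0 < β) (hβ1 : β < 1) (hK : 0 ≤ K)
    (hb0 : ∀ n, 0 ≤ b n)
    (hb : ∀ (n : ℕ) (R : ℝ), 0 < R → b n ≤ K * (n.factorial / R ^ n * Real.exp (β * R))) :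
    Summable b := by
  rw [← summable_nat_add_iff 1]
  have hgeo : Summable fun n : ℕ => (n : ℝ) ^ 1 * β ^ n :=
    summable_pow_mul_geometric_of_norm_lt_one 1 (by rwa [Real.norm_of_nonneg hβ.le])
  refine Summable.of_nonneg_of_le (fun n => hb0 _) (fun n => ?_)
    (((summable_nat_add_iff 1).2 hgeo).mul_left (K * (Stirling.stirlingSeq 1 * 2)))
  set k := n + 1 with hk
  have hkp : (0 : ℝ) < k := by rw [hk]; positivity
  have hk1 : (1 : ℝ) ≤ k := by rw [hk]; push_cast; linarith [n.cast_nonneg (α := ℝ)]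
  have hst : Stirling.stirlingSeq k ≤ Stirling.stirlingSeq 1 :=
    Stirling.stirlingSeq'_antitone (Nat.zero_le n)
  have hs0 : 0 ≤ Stirling.stirlingSeq 1 := by rw [Stirling.stirlingSeq]; positivity
  have hsq : √(2 * k : ℝ) ≤ 2 * k := Real.sqrt_le_iff.2 ⟨by positivity, by nlinarith⟩
  have hfac : (k.factorial : ℝ) =
      Stirling.stirlingSeq k * (√(2 * k : ℝ) * (k / Real.exp 1) ^ k) := by
    rw [Stirling.stirlingSeq, div_mul_cancel₀]
    positivity
  have hexp : Real.exp (β * (k / β)) = Real.exp 1 ^ k := by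
    rw [← Real.exp_nat_mul]; congr 1; field_simp
  calc b k ≤ K * (k.factorial / (k / β) ^ k * Real.exp (β * (k / β))) := hb k _ (by positivity)
    _ = K * (Stirling.stirlingSeq k * √(2 * k : ℝ)) * β ^ k := by
        rw [hexp, hfac, div_pow, div_pow]
        field_simp
    _ ≤ K * (Stirling.stirlingSeq 1 * (2 * k)) * β ^ k := by gcongr
    _ = K * (Stirling.stirlingSeq 1 * 2) * ((k : ℝ) ^ 1 * β ^ k) := by ring

/-! ### Exponential functions as eigenvectors of differentiation -/

/-- In the complementary range the exponent `α r^m` dominates `r` up to a constant. -/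
lemma exists_le_mul_rpow_add {α m : ℝ} (hα : 0 < α) (h : ¬(m < 1 ∨ (m = 1 ∧ α < 1))) :
    ∃ C : ℝ, ∀ r : ℝ, 0 ≤ r → r ≤ α * r ^ m + C := by
  push Not at h
  rcases h.1.eq_or_lt with h1 | h1
  · refine ⟨0, fun r hr => ?_⟩
    have := h.2 h1.symm
    rw [← h1, Real.rpow_one]
    nlinarith
  · -- beyond the radius `s`, where `α s ^ (m - 1) = 1`, no constant is needed
    set s := α⁻¹ ^ (m - 1)⁻¹ with hs
    have hs0 : 0 < s := by positivity
    refine ⟨s, fun r hr => ?_⟩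
    rcases le_total r s with hrs | hrs
    · have : 0 ≤ α * r ^ m := by positivity
      linarith
    · have hr0 : 0 < r := hs0.trans_le hrs
      have h2 : α⁻¹ ≤ r ^ (m - 1) := by
        have : s ^ (m - 1) = α⁻¹ := by
          rw [hs, ← Real.rpow_mul (by positivity), inv_mul_cancel₀ (by linarith), Real.rpow_one]
        rw [← this]
        exact Real.rpow_le_rpow hs0.le hrs (by linarith)
      have h3 : r ^ m = r ^ (m - 1) * r := by
        nth_rewrite 3 [← Real.rpow_one r]
        rw [← Real.rpow_add hr0, sub_add_cancel]
      have h4 : 1 ≤ α * r ^ (m - 1) := by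
        rwa [inv_le_iff_one_le_mul₀' hα] at h2
      rw [h3]
      nlinarith

lemma integrable_density_exp {p α m C : ℝ} (hp : 0 < p)
    (hC : ∀ r : ℝ, 0 ≤ r → r ≤ α * r ^ m + C) {l : ℂ} (hl : ‖l‖ < 1) :
    Integrable (density p α m fun z => Complex.exp (l * z)) := by
  have hb : 0 < p * (1 - ‖l‖) := mul_pos hp (by linarith)
  have hint : Integrable fun z : ℂ => Real.exp (-(p * (1 - ‖l‖)) * ‖z‖ ^ (1 : ℝ)) := by
    refine Integrable.of_integral_ne_zero ?_
    rw [Complex.integral_exp_neg_mul_rpow le_rfl hb]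
    have h1 := Real.Gamma_pos_of_pos (s := 2 / 1 + 1) (by norm_num)
    have h2 := Real.pi_pos
    positivity
  refine (hint.const_mul (Real.exp (p * C))).mono'
    (Measurable.aestronglyMeasurable (by unfold density; fun_prop))
    (Eventually.of_forall fun z => ?_)
  rw [density, Complex.norm_exp, ← Real.exp_mul, ← Real.exp_add, ← Real.exp_add,
    Real.norm_of_nonneg (Real.exp_pos _).le, Real.rpow_one]
  refine Real.exp_le_exp.2 ?_
  have h1 : (l * z).re ≤ ‖l‖ * ‖z‖ := (Complex.re_le_norm _).trans_eq (norm_mul _ _)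
  have h2 := mul_le_mul_of_nonneg_left (hC ‖z‖ (norm_nonneg _)) hp.le
  have h3 := mul_le_mul_of_nonneg_left h1 hp.le
  linarith

/-- Outside the range `m < 1` or `m = 1`, `α < 1`, the functions `e^{l z}` with `|l| < 1` belong
to the space and are eigenvectors of the differentiation operator. -/
lemma exists_eigenvector {p α m : ℝ} [hp : Fact (1 ≤ p)] (hα : 0 < α)
    (h : ¬(m < 1 ∨ (m = 1 ∧ α < 1))) {D : FockSpace p α m →L[ℂ] FockSpace p α m}
    (hD : IsRealizedBy deriv D) (l : ℂ) (hl : ‖l‖ < 1) :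
    ∃ f : FockSpace p α m, f ≠ 0 ∧ D f = l • f := by
  obtain ⟨C, hC⟩ := exists_le_mul_rpow_add hα h
  refine ⟨FockSpace.mk (fun z => Complex.exp (l * z)) (by fun_prop)
    (integrable_density_exp (by linarith [hp.out]) hC hl), fun h0 => ?_, ?_⟩
  · have := congrArg (fun f : FockSpace p α m => f 0) h0
    simp [FockSpace.mk_apply, FockSpace.zero_apply] at this
  · refine FockSpace.ext_apply fun z => ?_
    rw [hD, FockSpace.smul_apply, FockSpace.mk_apply]
    have : HasDerivAt (fun z => Complex.exp (l * z)) (Complex.exp (l * z) * (l * 1)) z :=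
      ((hasDerivAt_id z).const_mul l).cexp
    rw [mul_one, mul_comm] at this
    exact this.deriv

/-- The powers of `D` are summable when `α r^m ≤ β r + C` with `β < 1`. -/
lemma exists_deriv_summable {p α m : ℝ} [Fact (1 ≤ p)] (hα : 0 < α) (hm : 0 < m)
    (h : m < 1 ∨ (m = 1 ∧ α < 1)) :
    ∃ D : FockSpace p α m →L[ℂ] FockSpace p α m,
      IsRealizedBy deriv D ∧ Summable fun n => ‖D ^ n‖ := by
  have hm1 : m ≤ 1 := h.elim le_of_lt fun h => h.1.le
  obtain ⟨D, hD, hn⟩ := FockSpace.exists_deriv (p := p) hα.le hm.le hm1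
  obtain ⟨β, C, hβ, hβ1, hC⟩ := exists_mul_rpow_le hα hm h
  refine ⟨D, hD, summable_of_le_factorial hβ hβ1 (Real.exp_pos C).le (fun n => norm_nonneg _)
    fun n R hR => (hn n R hR).trans ?_⟩
  calc n.factorial / R ^ n * Real.exp (α * R ^ m)
      ≤ n.factorial / R ^ n * Real.exp (β * R + C) := by
        gcongr
        exact hC R hR.le
    _ = Real.exp C * (n.factorial / R ^ n * Real.exp (β * R)) := by rw [Real.exp_add]; ring

end Fock

theorem proposition5p1 (p α m : ℝ) [Fact (1 ≤ p)] (hα : 0 < α) (hm : 0 < m) :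
    (∃ H : FockSpace p α m →L[ℂ] FockSpace p α m,
      Fock.IsRealizedBy Fock.hardy H ∧ Fock.RittCondition H) ∧
    ((∃ D : FockSpace p α m →L[ℂ] FockSpace p α m,
        Fock.IsRealizedBy deriv D ∧ Fock.RittCondition D) ↔
      (∃ D : FockSpace p α m →L[ℂ] FockSpace p α m,
        Fock.IsRealizedBy deriv D ∧ Fock.PowerBounded D ∧ Fock.UniformlyMeanErgodic D)) ∧
    ((∃ D : FockSpace p α m →L[ℂ] FockSpace p α m,
        Fock.IsRealizedBy deriv D ∧ Fock.PowerBounded D ∧ Fock.UniformlyMeanErgodic D) ↔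
      (m < 1 ∨ (m = 1 ∧ α < 1))) := by
  have hergodic : (∃ D : FockSpace p α m →L[ℂ] FockSpace p α m,
      Fock.IsRealizedBy deriv D ∧ Fock.PowerBounded D ∧ Fock.UniformlyMeanErgodic D) ↔
      (m < 1 ∨ (m = 1 ∧ α < 1)) := by
    constructor
    · rintro ⟨D, hD, -, hD'⟩
      by_contra h
      exact Fock.not_uniformlyMeanErgodic_of_eigenvalues (Fock.exists_eigenvector hα h hD) hD'
    · intro h
      obtain ⟨D, hD, hs⟩ := Fock.exists_deriv_summable (p := p) hα hm h
      exact ⟨D, hD, Fock.powerBounded_of_summable hs, Fock.uniformlyMeanErgodic_of_summable hs⟩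
  have hritt : (∃ D : FockSpace p α m →L[ℂ] FockSpace p α m,
      Fock.IsRealizedBy deriv D ∧ Fock.RittCondition D) ↔ (m < 1 ∨ (m = 1 ∧ α < 1)) := by
    constructor
    · rintro ⟨D, hD, hD'⟩
      by_contra h
      exact Fock.not_rittCondition_of_eigenvalues (Fock.exists_eigenvector hα h hD) hD'
    · intro h
      obtain ⟨D, hD, hs⟩ := Fock.exists_deriv_summable (p := p) hα hm h
      have := FockSpace.completeSpace (p := p) hα.le hm.le
        (h.elim le_of_lt fun h => h.1.le)
      exact ⟨D, hD, Fock.rittCondition_of_summable hs⟩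
  refine ⟨?_, hritt.trans hergodic.symm, hergodic⟩
  obtain ⟨H, hH, hH'⟩ := FockSpace.exists_hardy (p := p) (α := α) (m := m)
  exact ⟨H, hH, FockSpace.rittCondition_of_isMultiplier_hardy hH'⟩
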